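/- Let $G$ be a countably infinite, connected graph of bounded degree with vertex set $V$, with no self-loops and no multiple edges; write $N_x$ for the set of neighbors of $x\in V$. Let $p$ be a real number greater than one. For $f\colon V\to\mathbb{R}$ put $$I_p(f,V)=\sum_{x\in V}\sum_{y\in N_x}|f(y)-f(x)|^p\in[0,\infty],\qquad \Delta_p f(x)=\sum_{y\in N_x}|f(y)-f(x)|^{p-2}(f(y)-f(x)),$$ where a summand of $\Delta_p f(x)$ with $f(y)=f(x)$ is read as $0$. Let $HD_p(G)$ be the set of all $f\colon V\to\mathbb{R}$ that are $p$-harmonic on $V$, i.e. $\Delta_p f(x)=0$ for every $x\in V$, and satisfy $I_p(f,V)<\infty$. For a finite set $A\subset V$ let $\mathrm{Cap}_p(A,\infty,V)=\inf_u I_p(u,V)$, the infimum being over all finitely supported $u\colon V\to\mathbb{R}$ with $u=1$ on $A$. Suppose that $G$ is $p$-parabolic, i.e. $\mathrm{Cap}_p(A,\infty,V)=0$ for some finite nonempty set $A\subset V$. Then $HD_p(G)$ consists precisely of the constant functions on $V$. -/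

import Mathlib

open scoped ENNReal

noncomputable section

namespace PHarmonic

variable {V : Type*} (G : SimpleGraph V)

/-- A graph has bounded degree if some positive integer bounds all vertex degrees. -/
def BoundedDegree [G.LocallyFinite] : Prop :=
  ∃ k : ℕ, 0 < k ∧ ∀ x : V, G.degree x ≤ k

/-- The `p`-th power of the gradient of `f` at `x`: the sum over the neighbors `y` of `x` of
`|f y - f x| ^ p`. -/
def gradPow [G.LocallyFinite] (p : ℝ) (f : V → ℝ) (x : V) : ℝ :=
  ∑ y ∈ G.neighborFinset x, |f y - f x| ^ p

/-- The `p`-Dirichlet sum `I_p(f, S)`, the sum of the gradient powers over `x ∈ S`, as an extended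
nonnegative real. -/
def dirichletSum [G.LocallyFinite] (p : ℝ) (f : V → ℝ) (S : Set V) : ℝ≥0∞ :=
  ∑' x : S, ENNReal.ofReal (gradPow G p f x)

/-- The `p`-Laplacian of `f` at `x`. A summand with `f y = f x` is zero for every `p`, since its
second factor vanishes. -/
def pLaplacian [G.LocallyFinite] (p : ℝ) (f : V → ℝ) (x : V) : ℝ :=
  ∑ y ∈ G.neighborFinset x, |f y - f x| ^ (p - 2) * (f y - f x)

/-- `f` is `p`-harmonic on `S`. -/
def IsPHarmonicOn [G.LocallyFinite] (p : ℝ) (f : V → ℝ) (S : Set V) : Prop :=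
  ∀ x ∈ S, pLaplacian G p f x = 0

/-- The space `D_p(G)` of `p`-Dirichlet finite functions. -/
def DirichletFinite [G.LocallyFinite] (p : ℝ) : Set (V → ℝ) :=
  {f | dirichletSum G p f Set.univ < ∞}

/-- The set `HD_p(G)` of functions that are `p`-harmonic on `V` and `p`-Dirichlet finite. -/
def HD [G.LocallyFinite] (p : ℝ) : Set (V → ℝ) :=
  {f | IsPHarmonicOn G p f Set.univ ∧ f ∈ DirichletFinite G p}

/-- The `p`-capacity `Cap_p(A, ∞, V)`: the infimum of `I_p(u, V)` over the finitely supported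
functions `u` on `V` that equal `1` on `A`. -/
def capacity [G.LocallyFinite] (p : ℝ) (A : Set V) : ℝ≥0∞ :=
  ⨅ u ∈ {u : V → ℝ | u.support.Finite ∧ ∀ x ∈ A, u x = 1}, dirichletSum G p u Set.univ

/-- `G` is `p`-parabolic if some finite nonempty set of vertices has zero `p`-capacity.
(The empty set always has zero `p`-capacity.) -/
def IsPParabolic [G.LocallyFinite] (p : ℝ) : Prop :=
  ∃ A : Set V, A.Finite ∧ A.Nonempty ∧ capacity G p A = 0

end PHarmonic

end

namespace PHarmonic

open Finset

variable {V : Type*} (G : SimpleGraph V) [G.LocallyFinite]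

/-! Test harmonicity of `f` against `u * arctan f`, with `u ≥ 0` a finitely supported cutoff of
small energy. As `f` may be unbounded, `arctan` supplies a bounded, strictly increasing substitute.
The product rule gives a sum of nonnegative edge terms, weighted by `u`, plus an error that Hölder
bounds by a multiple of `I_p(u)^(1/p)` (`mul_flux_mul_arctan_sub_le`). Parabolicity lets this tend
to `0` while `u` tends to `1` at each vertex, so every edge term vanishes and `f` is constant along
edges. -/

/-- The `p`-flux of `f` along the pair `(x, y)`, the summand of the `p`-Laplacian. -/
noncomputable def flux (p : ℝ) (f : V → ℝ) (x y : V) : ℝ :=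
  |f y - f x| ^ (p - 2) * (f y - f x)

theorem flux_swap (p : ℝ) (f : V → ℝ) (x y : V) : flux p f y x = -flux p f x y := by
  unfold flux
  rw [abs_sub_comm]
  ring

/-- With `q` conjugate to `p`, `(p - 1) * q = p` turns the `q`-th power of the flux into the energy
density of `f`. -/
theorem abs_flux {p : ℝ} (hp : 1 < p) (f : V → ℝ) (x y : V) :
    |flux p f x y| = |f y - f x| ^ (p - 1) := by
  unfold flux
  rcases eq_or_ne (f y - f x) 0 with h | h
  · rw [h, mul_zero, abs_zero, Real.zero_rpow (by linarith)]
  · rw [abs_mul, abs_of_nonneg (Real.rpow_nonneg (abs_nonneg _) _)]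
    nth_rewrite 2 [← Real.rpow_one |f y - f x|]
    rw [← Real.rpow_add (abs_pos.mpr h)]
    ring_nf

theorem gradPow_nonneg (p : ℝ) (f : V → ℝ) (x : V) : 0 ≤ gradPow G p f x :=
  Finset.sum_nonneg fun _ _ => Real.rpow_nonneg (abs_nonneg _) _

theorem sum_gradPow_le {p : ℝ} {f : V → ℝ} (hf : dirichletSum G p f Set.univ < ⊤)
    (S : Finset V) : ∑ x ∈ S, gradPow G p f x ≤ (dirichletSum G p f Set.univ).toReal := by
  have h : ∑ x ∈ S, ENNReal.ofReal (gradPow G p f x) ≤ dirichletSum G p f Set.univ := by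
    unfold dirichletSum
    rw [tsum_univ (fun x => ENNReal.ofReal (gradPow G p f x))]
    exact ENNReal.sum_le_tsum S
  rw [← ENNReal.ofReal_sum_of_nonneg fun x _ => gradPow_nonneg G p f x] at h
  exact (ENNReal.ofReal_le_iff_le_toReal hf.ne).mp h

theorem abs_sub_le_of_adj {p : ℝ} (hp : 1 < p) {f : V → ℝ}
    (hf : dirichletSum G p f Set.univ < ⊤) {x y : V} (h : G.Adj x y) :
    |f y - f x| ≤ (dirichletSum G p f Set.univ).toReal ^ (1 / p) := by
  have h1 : |f y - f x| ^ p ≤ (dirichletSum G p f Set.univ).toReal := by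
    refine le_trans ?_ (sum_gradPow_le G hf {x})
    rw [Finset.sum_singleton]
    exact Finset.single_le_sum (f := fun y => |f y - f x| ^ p)
      (fun _ _ => Real.rpow_nonneg (abs_nonneg _) _) ((G.mem_neighborFinset x y).mpr h)
  have h2 := Real.rpow_le_rpow (Real.rpow_nonneg (abs_nonneg _) _) h1
    (by positivity : (0 : ℝ) ≤ 1 / p)
  rwa [← Real.rpow_mul (abs_nonneg _), mul_one_div_cancel (by linarith), Real.rpow_one] at h2

/-- Meant for cutoffs: small energy keeps them near `1` at any fixed vertex. -/
theorem abs_sub_le_of_walk {p : ℝ} (hp : 1 < p) {f : V → ℝ}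
    (hf : dirichletSum G p f Set.univ < ⊤) {x y : V} (w : G.Walk x y) :
    |f y - f x| ≤ w.length * (dirichletSum G p f Set.univ).toReal ^ (1 / p) := by
  induction w with
  | nil => simp
  | @cons a b c h w ih =>
    have h1 := abs_sub_le_of_adj G hp hf h
    have h2 := abs_sub_le (f c) (f b) (f a)
    rw [SimpleGraph.Walk.length_cons]
    push_cast
    linarith

theorem dirichletSum_abs_le {p : ℝ} (hp : 1 < p) (f : V → ℝ) (S : Set V) :
    dirichletSum G p (fun x => |f x|) S ≤ dirichletSum G p f S := by
  refine ENNReal.tsum_le_tsum fun x => ENNReal.ofReal_le_ofReal (Finset.sum_le_sum fun y _ => ?_)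
  exact Real.rpow_le_rpow (abs_nonneg _) (abs_abs_sub_abs_le_abs_sub _ _) (by linarith)

/-- Summation by parts: the flux of a `p`-harmonic function has zero pairing with the gradient of
a finitely supported function. -/
theorem sum_flux_mul_sub_eq_zero {p : ℝ} {f : V → ℝ} (hf : IsPHarmonicOn G p f Set.univ)
    {φ : V → ℝ} {S : Finset V} (hS : ∀ x, φ x ≠ 0 → x ∈ S)
    (hN : ∀ x, φ x ≠ 0 → ∀ y, G.Adj x y → y ∈ S) :
    ∑ x ∈ S, ∑ y ∈ G.neighborFinset x, flux p f x y * (φ y - φ x) = 0 := by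
  classical
  have hlap : ∀ x, ∑ y ∈ G.neighborFinset x, flux p f x y = 0 := fun x => hf x trivial
  simp only [mul_sub, Finset.sum_sub_distrib, ← Finset.sum_mul, hlap, zero_mul,
    sub_zero]
  have hrw : ∀ x ∈ S, ∑ y ∈ G.neighborFinset x, flux p f x y * φ y
      = ∑ y ∈ S, if G.Adj x y then flux p f x y * φ y else 0 := by
    intro x _
    rw [← Finset.sum_filter]
    symm
    apply Finset.sum_subset_zero_on_sdiff
    · intro y hy
      simpa using (Finset.mem_filter.mp hy).2
    · intro y hy
      simp only [Finset.mem_sdiff, SimpleGraph.mem_neighborFinset, Finset.mem_filter,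
        not_and'] at hy
      rw [not_not.mp fun h => hy.2 hy.1 (hS y h), mul_zero]
    · exact fun _ _ => rfl
  -- After the swap, antisymmetry of the flux makes the coefficient of `φ y` minus the Laplacian at
  -- `y`.
  rw [Finset.sum_congr rfl hrw, Finset.sum_comm]
  refine Finset.sum_eq_zero fun y _ => ?_
  by_cases hy : φ y = 0
  · simp [hy]
  · rw [← Finset.sum_filter]
    have hset : S.filter (fun x => G.Adj x y) = G.neighborFinset y := by
      ext x
      simp only [Finset.mem_filter, SimpleGraph.mem_neighborFinset]
      exact ⟨fun h => h.2.symm, fun h => ⟨hN y hy x h, h.symm⟩⟩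
    rw [hset, ← Finset.sum_mul]
    simp only [fun x => flux_swap p f y x, Finset.sum_neg_distrib, hlap, neg_zero, zero_mul]

/-- Hölder's inequality for the pairing of the flux of `f` with the gradient of `u`. -/
theorem sum_abs_flux_mul_le {p : ℝ} (hp : 1 < p) {f u : V → ℝ}
    (hf : dirichletSum G p f Set.univ < ⊤) (hu : dirichletSum G p u Set.univ < ⊤)
    (S : Finset V) :
    ∑ x ∈ S, ∑ y ∈ G.neighborFinset x, |flux p f x y| * |u y - u x| ≤
      (dirichletSum G p f Set.univ).toReal ^ (1 / p.conjExponent) *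
        (dirichletSum G p u Set.univ).toReal ^ (1 / p) := by
  have hpq : p.HolderConjugate p.conjExponent := Real.HolderConjugate.conjExponent hp
  have hH := Real.inner_le_Lp_mul_Lq (S.sigma fun x => G.neighborFinset x)
    (fun i => |flux p f i.1 i.2|) (fun i => |u i.2 - u i.1|) hpq.symm
  rw [Finset.sum_sigma, Finset.sum_sigma, Finset.sum_sigma] at hH
  refine hH.trans ?_
  have e1 : ∀ x y, |flux p f x y| ^ p.conjExponent = |f y - f x| ^ p := by
    intro x y
    rw [abs_flux hp, ← Real.rpow_mul (abs_nonneg _), hpq.sub_one_mul_conj]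
  simp only [abs_abs, e1]
  have hq := hpq.symm.pos
  refine mul_le_mul (Real.rpow_le_rpow ?_ (sum_gradPow_le G hf S) (by positivity))
    (Real.rpow_le_rpow ?_ (sum_gradPow_le G hu S) (by positivity)) ?_ (by positivity)
  · exact Finset.sum_nonneg fun x _ => gradPow_nonneg G p f x
  · exact Finset.sum_nonneg fun x _ => gradPow_nonneg G p u x
  · exact Real.rpow_nonneg (Finset.sum_nonneg fun x _ => gradPow_nonneg G p u x) _

theorem flux_mul_arctan_sub_nonneg (p : ℝ) (f : V → ℝ) (x y : V) :
    0 ≤ flux p f x y * (Real.arctan (f y) - Real.arctan (f x)) := by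
  unfold flux
  rw [mul_assoc]
  refine mul_nonneg (Real.rpow_nonneg (abs_nonneg _) _) ?_
  rcases le_total (f x) (f y) with h | h
  · exact mul_nonneg (sub_nonneg.mpr h) (sub_nonneg.mpr (Real.arctan_mono h))
  · exact mul_nonneg_of_nonpos_of_nonpos (sub_nonpos.mpr h) (sub_nonpos.mpr (Real.arctan_mono h))

theorem eq_of_flux_mul_arctan_sub_eq_zero {p : ℝ} {f : V → ℝ} {x y : V}
    (h : flux p f x y * (Real.arctan (f y) - Real.arctan (f x)) = 0) : f x = f y := by
  by_contra hne
  have hd : f y - f x ≠ 0 := sub_ne_zero.mpr (Ne.symm hne)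
  rcases mul_eq_zero.mp h with h | h
  · exact mul_ne_zero (Real.rpow_pos_of_pos (abs_pos.mpr hd) _).ne' hd h
  · exact hne (Real.arctan_injective (sub_eq_zero.mp h)).symm

/-- Caccioppoli-type inequality: the arctangent-weighted energy of a `p`-harmonic function on one
edge, weighted by a nonnegative finitely supported `u`, is controlled by the energy of `u`. -/
theorem mul_flux_mul_arctan_sub_le {p : ℝ} (hp : 1 < p) {f u : V → ℝ}
    (hharm : IsPHarmonicOn G p f Set.univ) (hf : dirichletSum G p f Set.univ < ⊤)
    (hu : dirichletSum G p u Set.univ < ⊤) (hfin : u.support.Finite) (hpos : ∀ x, 0 ≤ u x)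
    {a b : V} (hab : G.Adj a b) :
    u b * (flux p f a b * (Real.arctan (f b) - Real.arctan (f a))) ≤
      2 * ((dirichletSum G p f Set.univ).toReal ^ (1 / p.conjExponent) *
        (dirichletSum G p u Set.univ).toReal ^ (1 / p)) := by
  classical
  let T : V → ℝ := fun x => Real.arctan (f x)
  -- Inserting `a` ensures that the edge `(a, b)` is summed even when `a` is far from the support of
  -- `u`.
  let S : Finset V := insert a (hfin.toFinset ∪ hfin.toFinset.biUnion fun x => G.neighborFinset x)
  have hsupp : ∀ x, u x * T x ≠ 0 → x ∈ hfin.toFinset := fun x hx => by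
    simpa using left_ne_zero_of_mul hx
  have hzero := sum_flux_mul_sub_eq_zero G hharm (φ := fun x => u x * T x) (S := S)
    (fun x hx => mem_insert_of_mem (mem_union_left _ (hsupp x hx)))
    (fun x hx y hxy => mem_insert_of_mem (mem_union_right _
      (mem_biUnion.mpr ⟨x, hsupp x hx, (G.mem_neighborFinset x y).mpr hxy⟩)))
  have hterm : ∀ x y, 0 ≤ u y * (flux p f x y * (T y - T x)) := fun x y =>
    mul_nonneg (hpos y) (flux_mul_arctan_sub_nonneg p f x y)
  have hT : ∀ x, |T x| ≤ 2 := fun x => by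
    rw [abs_le]
    have h1 := Real.arctan_lt_pi_div_two (f x)
    have h2 := Real.neg_pi_div_two_lt_arctan (f x)
    have h3 := Real.pi_lt_four
    constructor <;> simp only [T] <;> linarith
  have hle : u b * (flux p f a b * (T b - T a)) ≤
      ∑ x ∈ S, ∑ y ∈ G.neighborFinset x, u y * (flux p f x y * (T y - T x)) := by
    refine le_trans ?_ (Finset.single_le_sum
      (f := fun x => ∑ y ∈ G.neighborFinset x, u y * (flux p f x y * (T y - T x)))
      (fun x _ => Finset.sum_nonneg fun y _ => hterm x y) (mem_insert_self a _))
    exact Finset.single_le_sum (f := fun y => u y * (flux p f a y * (T y - T a)))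
      (fun y _ => hterm a y) ((G.mem_neighborFinset a b).mpr hab)
  refine hle.trans ((le_trans ?_ (mul_le_mul_of_nonneg_left
    (sum_abs_flux_mul_le G hp hf hu S) zero_le_two)))
  rw [← sub_zero (∑ x ∈ S, ∑ y ∈ G.neighborFinset x, u y * (flux p f x y * (T y - T x))),
    ← hzero, ← Finset.sum_sub_distrib, Finset.mul_sum]
  refine Finset.sum_le_sum fun x _ => ?_
  rw [← Finset.sum_sub_distrib, Finset.mul_sum]
  refine Finset.sum_le_sum fun y _ => ?_
  -- Discrete product rule: `u y * T y - u x * T x = u y * (T y - T x) + T x * (u y - u x)`.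
  calc u y * (flux p f x y * (T y - T x)) - flux p f x y * (u y * T y - u x * T x)
      = -(T x * (flux p f x y * (u y - u x))) := by ring
    _ ≤ |T x * (flux p f x y * (u y - u x))| := neg_le_abs _
    _ = |T x| * (|flux p f x y| * |u y - u x|) := by rw [abs_mul, abs_mul]
    _ ≤ 2 * (|flux p f x y| * |u y - u x|) :=
      mul_le_mul_of_nonneg_right (hT x) (by positivity)

/-- Zero capacity provides nonnegative finitely supported functions, equal to one on `A`, of
arbitrarily small energy. -/
theorem exists_cutoff {p : ℝ} (hp : 1 < p) {A : Set V} (hA : capacity G p A = 0) {ε : ℝ}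
    (hε : 0 < ε) :
    ∃ u : V → ℝ, u.support.Finite ∧ (∀ x ∈ A, u x = 1) ∧ (∀ x, 0 ≤ u x) ∧
      dirichletSum G p u Set.univ < ⊤ ∧ (dirichletSum G p u Set.univ).toReal ^ (1 / p) ≤ ε := by
  have hεp : 0 < ε ^ p := Real.rpow_pos_of_pos hε p
  have hlt : capacity G p A < ENNReal.ofReal (ε ^ p) := by
    rw [hA]
    exact ENNReal.ofReal_pos.mpr hεp
  obtain ⟨u, ⟨hfin, hone⟩, hu⟩ : ∃ u, (u.support.Finite ∧ ∀ x ∈ A, u x = 1) ∧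
      dirichletSum G p u Set.univ < ENNReal.ofReal (ε ^ p) := by
    simpa only [capacity, iInf_lt_iff, Set.mem_ofPred_eq, exists_prop] using hlt
  have hv := (dirichletSum_abs_le G hp u Set.univ).trans_lt hu
  refine ⟨fun x => |u x|, hfin.subset fun x hx => ?_, fun x hx => ?_, fun x => abs_nonneg _,
    hv.trans ENNReal.ofReal_lt_top, ?_⟩
  · simpa using hx
  · simp [hone x hx]
  · have h1 := ENNReal.toReal_mono ENNReal.ofReal_ne_top hv.le
    rw [ENNReal.toReal_ofReal hεp.le] at h1
    have h2 := Real.rpow_le_rpow ENNReal.toReal_nonneg h1 (by positivity : (0 : ℝ) ≤ 1 / p)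
    rwa [← Real.rpow_mul hε.le, mul_one_div_cancel (by linarith), Real.rpow_one] at h2

/-- On a connected `p`-parabolic graph, a `p`-harmonic function of finite energy takes equal values
at adjacent vertices. -/
theorem eq_of_adj_of_mem_HD (hconn : G.Connected) {p : ℝ} (hp : 1 < p) (hpar : IsPParabolic G p)
    {f : V → ℝ} (hf : f ∈ HD G p) {a b : V} (hab : G.Adj a b) : f a = f b := by
  obtain ⟨A, -, ⟨o, ho⟩, hA⟩ := hpar
  obtain ⟨hharm, hfin⟩ := hf
  obtain ⟨w⟩ := hconn.preconnected o b
  apply eq_of_flux_mul_arctan_sub_eq_zero (p := p)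
  have hK := flux_mul_arctan_sub_nonneg p f a b
  set K := flux p f a b * (Real.arctan (f b) - Real.arctan (f a)) with hKdef
  set C := (dirichletSum G p f Set.univ).toReal ^ (1 / p.conjExponent) with hC
  have hC0 : 0 ≤ C := Real.rpow_nonneg ENNReal.toReal_nonneg _
  -- From `(1 - w.length * ε) * K ≤ u b * K ≤ 2 * C * ε` follows `K ≤ ε * (2 * C + w.length * K)`;
  -- the `+ 1` makes the divisor positive.
  have hM : 0 < 2 * C + w.length * K + 1 := by positivity
  refine le_antisymm (le_of_forall_pos_le_add fun δ hδ => ?_) hK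
  obtain ⟨u, hus, hu1, hu0, hut, hue⟩ := exists_cutoff G hp hA (div_pos hδ hM)
  have h1 := mul_flux_mul_arctan_sub_le G hp hharm hfin hut hus hu0 hab
  have h2 := abs_sub_le_of_walk G hp hut w
  rw [← hKdef, ← hC] at h1
  rw [hu1 o ho] at h2
  set ε := (dirichletSum G p u Set.univ).toReal ^ (1 / p)
  have h3 : (1 - w.length * ε) * K ≤ u b * K :=
    mul_le_mul_of_nonneg_right (by linarith [(abs_le.mp h2).1]) hK
  have hε0 : 0 ≤ ε := Real.rpow_nonneg ENNReal.toReal_nonneg _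
  calc K ≤ ε * (2 * C + w.length * K + 1) := by linarith
    _ ≤ δ := (le_div_iff₀ hM).mp hue
    _ = 0 + δ := (zero_add δ).symm

theorem const_mem_HD {p : ℝ} (hp : 1 < p) (c : ℝ) : (fun _ : V => c) ∈ HD G p := by
  refine ⟨fun x _ => by simp [pLaplacian], ?_⟩
  have hp0 : p ≠ 0 := by linarith
  simp [DirichletFinite, dirichletSum, gradPow, Real.zero_rpow hp0]

end PHarmonic

theorem theorem2p2 {V : Type*} [Countable V] [Infinite V]
    (G : SimpleGraph V) [G.LocallyFinite] (hconn : G.Connected)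
    (hdeg : PHarmonic.BoundedDegree G) (p : ℝ) (hp : 1 < p)
    (hpar : PHarmonic.IsPParabolic G p) :
    PHarmonic.HD G p = Set.range (fun (c : ℝ) (_ : V) => c) := by
  refine Set.Subset.antisymm (fun f hf => ?_) ?_
  · obtain ⟨o⟩ := hconn.nonempty
    refine ⟨f o, funext fun x => ?_⟩
    obtain ⟨w⟩ := hconn.preconnected o x
    induction w with
    | nil => rfl
    | cons h _ ih => exact (PHarmonic.eq_of_adj_of_mem_HD G hconn hp hpar hf h).trans ih
  · rintro _ ⟨c, rfl⟩
    exact PHarmonic.const_mem_HD G hp c
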